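/- Let $X$ be an at most countable set and let $m\colon X\to(0,\infty)$, extended to a measure on $X$ by additivity, satisfy $m(X)<\infty$. A \emph{Dirichlet form} is a densely defined, closed, real quadratic form $Q$ on the complex Hilbert space $\ell^2(X,m)$ with domain $D(Q)$ such that $C\circ u\in D(Q)$ and $Q(C\circ u)\le Q(u)$ for all $u\in D(Q)$ and all normal contractions $C$, i.e. all maps $C\colon\mathbb{C}\to\mathbb{C}$ with $C(0)=0$ and $|C(s)-C(t)|\le|s-t|$ for $s,t\in\mathbb{C}$. Its \emph{generator} is the self-adjoint operator $L\ge 0$ on $\ell^2(X,m)$ with $D(L^{1/2})=D(Q)$ and $Q(u)=\|L^{1/2}u\|_2^2$; equivalently, $D(L)$ consists of all $u\in D(Q)$ for which there is $f\in\ell^2(X,m)$ with $Q(u,v)=\langle f,v\rangle$ for all $v\in D(Q)$, and $Lu=f$. \textbf{Proposition.} Let $Q$ be a Dirichlet form on $\ell^2(X,m)$ with generator $L$, and suppose that $Q$ satisfies an $\ell^\infty_{\alpha,o}$-Sobolev inequality for some $\alpha\ge 0$ and $o\in X$, that is, there is a constant $S$ such that $$\|u\|_\infty^2\le S\bigl(Q(u)+\alpha|u(o)|^2\bigr)\qquad\text{for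 all }u\in D(Q).$$ Then, for every $t>0$, the operator $e^{-tL}$ is trace class on $\ell^2(X,m)$. In particular, the spectrum of $L$ is purely discrete, i.e. it consists of isolated points that are eigenvalues of finite multiplicity. (Here $(e^{-tL})_{t\ge0}$ is the unique strongly continuous semigroup of bounded operators on $\ell^2(X,m)$ with infinitesimal generator $-L$.) -/

import Mathlib

open MeasureTheory Filter Topology
open scoped NNReal ENNReal ComplexConjugate InnerProductSpace

noncomputable section

namespace DiscreteDirichlet

/-! ### Operators on Hilbert spaces -/

section Operators

universe u

variable {H : Type u} [NormedAddCommGroup H] [InnerProductSpace ℂ H]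

/-- A bounded operator `T` on a Hilbert space is trace class if
`∑ᵢ ⟨|T| eᵢ, eᵢ⟩ < ∞` for every orthonormal (Hilbert) basis `e`, where `|T| = (T* T)^{1/2}`.
Orthonormal bases are indexed by sets of vectors; such bases always exist. -/
def IsTraceClass [CompleteSpace H] (T : H →L[ℂ] H) : Prop :=
  ∀ (s : Set H) (e : HilbertBasis s ℂ H),
    Summable fun i : s => (⟪CFC.abs T (e i), e i⟫_ℂ).re

/-- The resolvent set of a (possibly unbounded) operator `L`: all `z` for which
`L - z : D(L) → H` is a bijection with bounded inverse `R`. -/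
def resolventSet (L : H →ₗ.[ℂ] H) : Set ℂ :=
  {z | ∃ R : H →L[ℂ] H,
    (∀ f : H, ∃ h : R f ∈ L.domain, L ⟨R f, h⟩ - z • R f = f) ∧
    (∀ u : L.domain, R (L u - z • (u : H)) = u)}

/-- The spectrum of a (possibly unbounded) operator. -/
def operatorSpectrum (L : H →ₗ.[ℂ] H) : Set ℂ := (resolventSet L)ᶜ

/-- The eigenspace `{u ∈ D(L) : L u = z u}`. -/
def eigenspace (L : H →ₗ.[ℂ] H) (z : ℂ) : Submodule ℂ H where
  carrier := {u | (u, z • u) ∈ L.graph}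
  zero_mem' := by
    have h := L.graph.zero_mem
    change ((0 : H), z • (0 : H)) ∈ L.graph
    rw [smul_zero]
    exact h
  add_mem' := by
    intro a b ha hb
    have h := L.graph.add_mem ha hb
    simpa [smul_add] using h
  smul_mem' := by
    intro c a ha
    have h := L.graph.smul_mem c ha
    simpa [smul_comm z c a] using h

/-- The spectrum of `L` is purely discrete: it consists of isolated points (of the spectrum) that
are eigenvalues of finite multiplicity. -/
def HasPurelyDiscreteSpectrum (L : H →ₗ.[ℂ] H) : Prop :=
  ∀ z ∈ operatorSpectrum L,
    (∃ ε : ℝ, 0 < ε ∧ ∀ w ∈ operatorSpectrum L, w ≠ z → ε ≤ dist w z) ∧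
    eigenspace L z ≠ ⊥ ∧ FiniteDimensional ℂ (eigenspace L z)

/-- `T` is the semigroup `(e^{-tL})_{t ≥ 0}`, i.e. the strongly continuous semigroup of bounded
operators whose infinitesimal generator is `-L`: one has `u ∈ D(L)` and `L u = w` if and only if
`(u - T_t u) / t → w` as `t ↓ 0`. -/
structure IsSemigroupOf (L : H →ₗ.[ℂ] H) (T : ℝ≥0 → H →L[ℂ] H) : Prop where
  map_zero : T 0 = ContinuousLinearMap.id ℂ H
  map_add : ∀ s t : ℝ≥0, T (s + t) = (T s).comp (T t)
  continuous : ∀ u : H, Continuous fun t : ℝ≥0 => T t u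
  generator : ∀ u w : H, (u, w) ∈ L.graph ↔
    Tendsto (fun t : ℝ≥0 => (((t : ℝ) : ℂ)⁻¹) • (u - T t u)) (𝓝[>] 0) (𝓝 w)

end Operators

/-! ### Discrete measure spaces and Dirichlet forms -/

section Forms

universe u

variable {X : Type u} [MeasurableSpace X]

/-- The measure on `X` that gives each point `x` the mass `m x`. -/
def weightMeasure (m : X → ℝ) : Measure X :=
  Measure.sum fun x => ENNReal.ofReal (m x) • Measure.dirac x

/-- The complex Hilbert space `ℓ²(X, m)`. -/
abbrev Ell2 (m : X → ℝ) : Type u := Lp ℂ 2 (weightMeasure m)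

/-- A real (i.e. real-valued) quadratic form on `ℓ²(X, m)`, given by its domain and its Hermitian
sesquilinear form. -/
structure QuadForm (m : X → ℝ) where
  domain : Submodule ℂ (Ell2 m)
  form : domain →ₗ⋆[ℂ] domain →ₗ[ℂ] ℂ
  hermitian : ∀ u v : domain, conj (form u v) = form v u

namespace QuadForm

variable {m : X → ℝ}

/-- `Q(u)` for `u ∈ D(Q)`; the number `form u u` is real since the form is Hermitian. -/
def energy (Q : QuadForm m) (u : Q.domain) : ℝ := (Q.form u u).re

/-- `Q` is closed: every sequence in `D(Q)` that converges in `ℓ²` and is Cauchy with respect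
to `Q` has its limit in `D(Q)` and converges to it with respect to `Q`. -/
def IsClosedForm (Q : QuadForm m) : Prop :=
  ∀ (u : ℕ → Q.domain) (v : Ell2 m),
    Tendsto (fun n => (u n : Ell2 m)) atTop (𝓝 v) →
    Tendsto (fun p : ℕ × ℕ => Q.energy (u p.1 - u p.2)) atTop (𝓝 0) →
    ∃ hv : v ∈ Q.domain, Tendsto (fun n => Q.energy (u n - ⟨v, hv⟩)) atTop (𝓝 0)

/-- A Dirichlet form: a densely defined closed real quadratic form such that `C ∘ u ∈ D(Q)` and
`Q(C ∘ u) ≤ Q(u)` for all `u ∈ D(Q)` and all normal contractions `C : ℂ → ℂ`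
(1-Lipschitz maps with `C 0 = 0`). Taking `C = 0` shows that `Q` is nonnegative. -/
structure IsDirichletForm (Q : QuadForm m) : Prop where
  dense : Dense (Q.domain : Set (Ell2 m))
  closed : Q.IsClosedForm
  contraction : ∀ (C : ℂ → ℂ) (hC : LipschitzWith 1 C) (hC0 : C 0 = 0) (u : Q.domain),
    ∃ h : hC.compLp hC0 (u : Ell2 m) ∈ Q.domain, Q.energy ⟨_, h⟩ ≤ Q.energy u

/-- The `ℓ^p_{α,o}`-Sobolev inequality `‖u‖_p² ≤ S (Q(u) + α |u(o)|²)` for all `u ∈ D(Q)`.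
The norm takes values in `[0, ∞]`, so the inequality entails `u ∈ ℓ^p`. -/
def SatisfiesSobolev (Q : QuadForm m) (p : ℝ≥0∞) (α : ℝ) (o : X) : Prop :=
  ∃ S : ℝ, ∀ u : Q.domain,
    (eLpNorm ((u : Ell2 m) : X → ℂ) p (weightMeasure m)) ^ 2 ≤
      ENNReal.ofReal (S * (Q.energy u + α * ‖((u : Ell2 m) : X → ℂ) o‖ ^ 2))

/-- The graph of the generator: all `(u, f)` with `u ∈ D(Q)` and `Q(u, v) = ⟨f, v⟩` for
all `v ∈ D(Q)`. -/
def generatorGraph (Q : QuadForm m) : Submodule ℂ (Ell2 m × Ell2 m) where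
  carrier := {x | ∃ hu : x.1 ∈ Q.domain, ∀ v : Q.domain,
    Q.form ⟨x.1, hu⟩ v = ⟪x.2, (v : Ell2 m)⟫_ℂ}
  zero_mem' := by
    refine ⟨Q.domain.zero_mem, fun v => ?_⟩
    have h : (⟨0, Q.domain.zero_mem⟩ : Q.domain) = 0 := rfl
    simp [h]
  add_mem' := by
    rintro a b ⟨ha, ha'⟩ ⟨hb, hb'⟩
    refine ⟨Q.domain.add_mem ha hb, fun v => ?_⟩
    have h : (⟨a.1 + b.1, Q.domain.add_mem ha hb⟩ : Q.domain) = ⟨a.1, ha⟩ + ⟨b.1, hb⟩ := rfl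
    change Q.form ⟨a.1 + b.1, _⟩ v = ⟪a.2 + b.2, (v : Ell2 m)⟫_ℂ
    rw [h, map_add, LinearMap.add_apply, ha', hb', inner_add_left]
  smul_mem' := by
    rintro c a ⟨ha, ha'⟩
    refine ⟨Q.domain.smul_mem c ha, fun v => ?_⟩
    have h : (⟨c • a.1, Q.domain.smul_mem c ha⟩ : Q.domain) = c • ⟨a.1, ha⟩ := rfl
    change Q.form ⟨c • a.1, _⟩ v = ⟪c • a.2, (v : Ell2 m)⟫_ℂ
    rw [h, LinearMap.map_smulₛₗ, LinearMap.smul_apply, ha', inner_smul_left, smul_eq_mul]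

/-- The generator `L` of `Q`: the operator with `D(L) = {u ∈ D(Q) : ∃ f ∈ ℓ², ∀ v ∈ D(Q),
Q(u, v) = ⟨f, v⟩}` and `L u = f`. For a densely defined closed nonnegative form it is the
self-adjoint operator `L ≥ 0` with `D(L^{1/2}) = D(Q)` and `Q(u) = ‖L^{1/2} u‖²`. -/
def generator (Q : QuadForm m) : Ell2 m →ₗ.[ℂ] Ell2 m := Q.generatorGraph.toLinearPMap

/-- For a densely defined form, `f` is determined by `u`, so that the graph of the generator is
indeed `generatorGraph`. -/
theorem generator_graph (Q : QuadForm m) (hQ : Dense (Q.domain : Set (Ell2 m))) :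
    Q.generator.graph = Q.generatorGraph := by
  refine Submodule.toLinearPMap_graph_eq _ ?_
  rintro ⟨u, f⟩ ⟨hu, h⟩ (rfl : u = 0)
  refine hQ.eq_zero_of_inner_left (𝕜 := ℂ) fun v hv => ?_
  have h0 : (⟨0, hu⟩ : Q.domain) = 0 := rfl
  rw [← h ⟨v, hv⟩, h0]
  simp

end QuadForm

end Forms

end DiscreteDirichlet

end

/-! Give `D(Q)` the inner product `Q(u,v) + ⟨u,v⟩`. Since `Q` is closed, this is a Hilbert space
`V`; let `J : V → ℓ²` be the inclusion. Then `J J* = (L+1)⁻¹`. Evaluation at `o` is bounded on `ℓ²`,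
so the Sobolev inequality becomes `|Jv(x)| ≤ C‖v‖`, uniformly in `x`.

As `m(X) < ∞`, this bound makes `J` a norm limit of finite-rank truncations
(`isCompactOperator_of_sup_bound`), so `J J*` has an orthonormal eigenbasis `bᵢ` with eigenvalues
`μᵢ ∈ (0,1]`. The bound also gives `∑ μᵢ|bᵢ(x)|² ≤ C²` at every `x`; integrating, `∑ μᵢ ≤ C² m(X)`
(`summable_eigenvalues_of_sup_bound`).

Hence `L` is diagonal with eigenvalues `λᵢ = μᵢ⁻¹ - 1 ≥ 0` and `∑ (1+λᵢ)⁻¹ < ∞`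
(`QuadForm.exists_isDiagonal_generator`). The rest concerns diagonal operators: `e^{-tλ}` is at most
a constant times `(1+λ)⁻¹`, which gives the trace class property, and `λᵢ → ∞` gives discreteness of
the spectrum. -/

namespace DiscreteDirichlet

/-! ### Diagonal operators in a Hilbert basis. -/

section Diagonal

variable {H : Type*} [NormedAddCommGroup H] [InnerProductSpace ℂ H] {ι : Type*}

/-- Parseval's identity. -/
theorem hasSum_norm_inner_sq (b : HilbertBasis ι ℂ H) (x : H) :
    HasSum (fun i => ‖⟪b i, x⟫_ℂ‖ ^ 2) (‖x‖ ^ 2) := by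
  have h := lp.hasSum_norm (p := 2) (by simp) (b.repr x)
  simpa [b.repr_apply_apply] using h

theorem ext_inner_basis (b : HilbertBasis ι ℂ H) {x y : H}
    (h : ∀ i, ⟪b i, x⟫_ℂ = ⟪b i, y⟫_ℂ) : x = y := by
  apply b.repr.injective
  ext i
  simp only [b.repr_apply_apply, h]

/-- Convergence in a Hilbert space from dominated convergence of the coefficients. -/
theorem tendsto_of_tendsto_inner_basis (b : HilbertBasis ι ℂ H) {α : Type*} {l : Filter α}
    {f : α → H} {y : H} {c : ι → ℝ} (hc : Summable c)
    (hb : ∀ᶠ a in l, ∀ i, ‖⟪b i, f a - y⟫_ℂ‖ ^ 2 ≤ c i)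
    (h : ∀ i, Tendsto (fun a => ⟪b i, f a⟫_ℂ) l (𝓝 ⟪b i, y⟫_ℂ)) : Tendsto f l (𝓝 y) := by
  have h1 : Tendsto (fun a => ∑' i, ‖⟪b i, f a - y⟫_ℂ‖ ^ 2) l (𝓝 (∑' _ : ι, 0)) := by
    refine tendsto_tsum_of_dominated_convergence hc (fun i => ?_) ?_
    · have h2 := ((h i).sub_const ⟪b i, y⟫_ℂ).norm.pow 2
      simpa [inner_sub_right] using h2
    · filter_upwards [hb] with a ha i
      simpa using ha i
  simp only [(hasSum_norm_inner_sq b _).tsum_eq, tsum_zero] at h1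
  rw [tendsto_iff_norm_sub_tendsto_zero]
  have h3 := h1.sqrt
  simpa using h3

/-- Bounded diagonal operators exist. -/
theorem exists_diagonal (b : HilbertBasis ι ℂ H) (d : ι → ℂ) (C : ℝ) (hd : ∀ i, ‖d i‖ ≤ C) :
    ∃ D : H →L[ℂ] H, ∀ x i, ⟪b i, D x⟫_ℂ = d i * ⟪b i, x⟫_ℂ := by
  -- The absolute value matters only for empty `ι`, where `C` may be negative.
  have hbd : ∀ (x : H) i, ‖d i * ⟪b i, x⟫_ℂ‖ ≤ |C| * ‖⟪b i, x⟫_ℂ‖ := fun x i => by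
    rw [norm_mul]
    gcongr
    exact (hd i).trans (le_abs_self C)
  have hmem : ∀ x : H, Memℓp (fun i => d i * ⟪b i, x⟫_ℂ) 2 := fun x => by
    have h0 : Memℓp (fun i => ((|C| : ℝ) : ℂ) * ⟪b i, x⟫_ℂ) 2 := by
      have := (lp.memℓp (b.repr x)).const_mul ((|C| : ℝ) : ℂ)
      simpa only [b.repr_apply_apply] using this
    refine h0.mono' fun i => ?_
    simpa using hbd x i
  let A : H →ₗ[ℂ] H :=
    { toFun := fun x => b.repr.symm ⟨_, hmem x⟩
      map_add' := fun x y => by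
        rw [← map_add]
        congr 1
        ext i
        change _ = d i * ⟪b i, x⟫_ℂ + d i * ⟪b i, y⟫_ℂ
        simp [mul_add]
      map_smul' := fun c x => by
        rw [RingHom.id_apply, ← map_smul]
        congr 1
        ext i
        simp [mul_left_comm] }
  have hA : ∀ x i, ⟪b i, A x⟫_ℂ = d i * ⟪b i, x⟫_ℂ := fun x i => by
    rw [← b.repr_apply_apply]
    simp [A]
  refine ⟨A.mkContinuous |C| fun x => ?_, hA⟩
  rw [← pow_le_pow_iff_left₀ (norm_nonneg _) (by positivity) two_ne_zero, mul_pow]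
  refine hasSum_le (fun i => ?_) (hasSum_norm_inner_sq b (A x))
    ((hasSum_norm_inner_sq b x).mul_left _)
  rw [hA, ← mul_pow]
  gcongr
  exact hbd x i

theorem inner_basis_self (b : HilbertBasis ι ℂ H) (i : ι) : ⟪b i, b i⟫_ℂ = 1 := by
  simp [b.orthonormal.1 i]

theorem inner_basis_of_ne (b : HilbertBasis ι ℂ H) {i j : ι} (h : i ≠ j) : ⟪b i, b j⟫_ℂ = 0 :=
  b.orthonormal.2 h

/-- `L` is the (maximal) diagonal operator with eigenvalues `lam` in the Hilbert basis `b`. -/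
def IsDiagonal (L : H →ₗ.[ℂ] H) (b : HilbertBasis ι ℂ H) (lam : ι → ℝ) : Prop :=
  ∀ u w : H, (u, w) ∈ L.graph ↔ ∀ i, ⟪b i, w⟫_ℂ = (lam i : ℂ) * ⟪b i, u⟫_ℂ

variable {L : H →ₗ.[ℂ] H} {b : HilbertBasis ι ℂ H} {lam : ι → ℝ}

theorem IsDiagonal.smul_basis_mem_graph (hL : IsDiagonal L b lam) (i : ι) :
    (b i, (lam i : ℂ) • b i) ∈ L.graph := by
  rw [hL]
  intro j
  rw [inner_smul_right]
  obtain rfl | h := eq_or_ne j i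
  · rfl
  · simp [inner_basis_of_ne b h]

/-! ### Semigroups generated by diagonal operators. -/

theorem abs_exp_neg_sub_exp_neg_le_one {x y : ℝ} (hx : 0 ≤ x) (hy : 0 ≤ y) :
    |Real.exp (-x) - Real.exp (-y)| ≤ 1 := by
  have h1 := Real.exp_le_one_iff.2 (neg_nonpos.2 hx)
  have h2 := Real.exp_le_one_iff.2 (neg_nonpos.2 hy)
  rw [abs_le]
  constructor <;> linarith [Real.exp_pos (-x), Real.exp_pos (-y)]

theorem tendsto_one_sub_exp_div (a : ℝ) :
    Tendsto (fun t : ℝ≥0 => (t : ℝ)⁻¹ * (1 - Real.exp (-(t * a)))) (𝓝[>] 0) (𝓝 a) := by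
  have h : HasDerivAt (fun t : ℝ => -Real.exp (-(t * a))) a 0 := by
    simpa [Function.comp_def, Pi.neg_def] using
      (((hasDerivAt_id (0 : ℝ)).mul_const a).neg.exp).neg
  have h1 := h.tendsto_slope_zero_right
  have h2 : Tendsto (fun t : ℝ≥0 => (t : ℝ)) (𝓝[>] 0) (𝓝[>] 0) := by
    refine tendsto_nhdsWithin_iff.2 ⟨?_, ?_⟩
    · exact (NNReal.continuous_coe.tendsto' 0 0 rfl).mono_left nhdsWithin_le_nhds
    · filter_upwards [self_mem_nhdsWithin] with t ht
      exact NNReal.coe_pos.2 ht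
  refine (h1.comp h2).congr fun t => ?_
  simp only [Function.comp_apply, zero_add, zero_mul, neg_zero, Real.exp_zero, smul_eq_mul]
  ring

/-- A diagonal operator with nonnegative eigenvalues generates a semigroup. -/
theorem IsDiagonal.exists_isSemigroupOf (hL : IsDiagonal L b lam) (h0 : ∀ i, 0 ≤ lam i) :
    ∃ T, IsSemigroupOf L T := by
  have hT : ∀ t : ℝ≥0, ∃ D : H →L[ℂ] H, ∀ x i,
      ⟪b i, D x⟫_ℂ = (Real.exp (-(t * lam i)) : ℝ) * ⟪b i, x⟫_ℂ := fun t => by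
    refine exists_diagonal b (fun i => ((Real.exp (-(t * lam i)) : ℝ) : ℂ)) 1 fun i => ?_
    rw [Complex.norm_real, Real.norm_of_nonneg (Real.exp_nonneg _), Real.exp_le_one_iff]
    have := mul_nonneg t.2 (h0 i)
    simpa using this
  choose T hT using hT
  refine ⟨T, ?_, ?_, ?_, ?_⟩
  · ext x
    refine ext_inner_basis b fun i => ?_
    simp [hT]
  · intro s t
    ext x
    refine ext_inner_basis b fun i => ?_
    rw [ContinuousLinearMap.comp_apply, hT, hT, hT, ← mul_assoc, ← Complex.ofReal_mul,
      ← Real.exp_add]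
    congr 4
    push_cast
    ring
  · intro u
    rw [continuous_iff_continuousAt]
    intro s
    refine tendsto_of_tendsto_inner_basis b (hasSum_norm_inner_sq b u).summable
      (Eventually.of_forall fun t i => ?_) fun i => ?_
    · rw [inner_sub_right, hT, hT, ← sub_mul, norm_mul, ← Complex.ofReal_sub, Complex.norm_real]
      have h1 := abs_exp_neg_sub_exp_neg_le_one (mul_nonneg t.2 (h0 i)) (mul_nonneg s.2 (h0 i))
      gcongr
      exact mul_le_of_le_one_left (norm_nonneg _) h1
    · simp only [hT]
      exact Continuous.tendsto (by fun_prop) s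
  · intro u w
    rw [hL]
    have hcoef : ∀ (t : ℝ≥0) i, ⟪b i, ((t : ℝ) : ℂ)⁻¹ • (u - T t u)⟫_ℂ =
        (((t : ℝ)⁻¹ * (1 - Real.exp (-(t * lam i))) : ℝ) : ℂ) * ⟪b i, u⟫_ℂ := fun t i => by
      rw [inner_smul_right, inner_sub_right, hT]
      push_cast
      ring
    have hlim : ∀ i, Tendsto (fun t : ℝ≥0 => ⟪b i, ((t : ℝ) : ℂ)⁻¹ • (u - T t u)⟫_ℂ) (𝓝[>] 0)
        (𝓝 ((lam i : ℂ) * ⟪b i, u⟫_ℂ)) := fun i => by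
      simp only [hcoef]
      exact ((Complex.continuous_ofReal.tendsto _).comp
        (tendsto_one_sub_exp_div (lam i))).mul_const _
    constructor
    · intro h
      -- Since `0 ≤ (1 - e^{-tλ})/t ≤ λ`, the `i`-th coefficient of the error is at most `λᵢ|⟨bᵢ,u⟩|
      -- = |⟨bᵢ,w⟩|`, which is square summable.
      refine tendsto_of_tendsto_inner_basis b (hasSum_norm_inner_sq b w).summable ?_ fun i => ?_
      · filter_upwards [self_mem_nhdsWithin] with t ht i
        have ht' : 0 < (t : ℝ) := NNReal.coe_pos.2 ht
        rw [inner_sub_right, hcoef, h i, ← sub_mul, norm_mul, norm_mul, ← Complex.ofReal_sub,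
          Complex.norm_real, Complex.norm_real]
        gcongr
        rw [Real.norm_eq_abs, Real.norm_eq_abs, abs_of_nonneg (h0 i), abs_le]
        have h1 : Real.exp (-(t * lam i)) ≤ 1 := by
          rw [Real.exp_le_one_iff]
          exact neg_nonpos.2 (mul_nonneg t.2 (h0 i))
        have h2 := Real.add_one_le_exp (-(t * lam i))
        have h3 : 0 ≤ (t : ℝ)⁻¹ * (1 - Real.exp (-(t * lam i))) :=
          mul_nonneg (by positivity) (by linarith)
        have h4 : (t : ℝ)⁻¹ * (1 - Real.exp (-(t * lam i))) ≤ lam i := by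
          rw [inv_mul_le_iff₀ ht']
          linarith
        constructor <;> linarith [h0 i]
      · rw [h i]
        exact hlim i
    · intro h i
      exact tendsto_nhds_unique (((innerSL ℂ (b i)).continuous.tendsto w).comp h) (hlim i)

/-- A semigroup acts on eigenvectors of its generator by exponentials. -/
theorem IsSemigroupOf.apply_eigenvector {T : ℝ≥0 → H →L[ℂ] H} (hT : IsSemigroupOf L T) {u : H}
    {z : ℂ} (hu : (u, z • u) ∈ L.graph) (t : ℝ≥0) : T t u = Complex.exp (-(t * z)) • u := by
  let f : ℝ → H := fun s => T s.toNNReal u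
  have hf : Continuous f := (hT.continuous u).comp continuous_real_toNNReal
  -- By the semigroup law, the right difference quotient at `s` is `T s` applied to the one at `0`.
  -- Only right derivatives are available this way, and they suffice below.
  have hf' : ∀ s : ℝ, 0 ≤ s → HasDerivWithinAt f (-(z • f s)) (Set.Ici s) s := fun s hs => by
    rw [← hasDerivWithinAt_Ioi_iff_Ici, hasDerivWithinAt_iff_tendsto_slope' (by simp)]
    have h1 : Tendsto (fun r : ℝ => (r - s).toNNReal) (𝓝[>] s) (𝓝[>] 0) := by
      refine tendsto_nhdsWithin_iff.2 ⟨?_, ?_⟩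
      · have : Continuous fun r : ℝ => (r - s).toNNReal := by fun_prop
        exact (this.tendsto' s 0 (by simp)).mono_left nhdsWithin_le_nhds
      · filter_upwards [self_mem_nhdsWithin] with r hr
        simpa using hr
    have h2 := (((T s.toNNReal).continuous.tendsto _).comp
      (((hT.generator u _).1 hu).comp h1)).neg
    rw [map_smul] at h2
    refine h2.congr' ?_
    filter_upwards [self_mem_nhdsWithin] with r hr
    have hr' : 0 ≤ r - s := sub_nonneg.2 (le_of_lt hr)
    have h3 : f r = T s.toNNReal (T (r - s).toNNReal u) := by
      rw [← ContinuousLinearMap.comp_apply, ← hT.map_add, ← Real.toNNReal_add hs hr']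
      simp [f]
    rw [slope_def_module, h3]
    simp only [Function.comp_apply, map_smul, map_sub, Real.coe_toNNReal _ hr', f]
    rw [← smul_neg, neg_sub, ← Complex.ofReal_inv, Complex.coe_smul]
  -- This product has zero right derivative, hence is constant on `[0, t]`.
  let g : ℝ → H := fun s => Complex.exp (s * z) • f s
  have hg : ContinuousOn g (Set.Icc 0 (t : ℝ)) := by
    have : Continuous g := by fun_prop
    exact this.continuousOn
  have hg' : ∀ s ∈ Set.Ico 0 (t : ℝ), HasDerivWithinAt g 0 (Set.Ici s) s := fun s hs => by
    have h1 : HasDerivAt (fun s : ℝ => Complex.exp (s * z)) (Complex.exp (s * z) * z) s := by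
      have := ((Complex.ofRealCLM.hasDerivAt (x := s)).mul_const z).cexp
      simpa using this
    have h2 := h1.hasDerivWithinAt.smul (hf' s hs.1)
    rw [smul_neg, mul_smul, neg_add_cancel] at h2
    exact h2
  have h := constant_of_has_deriv_right_zero hg hg' t ⟨t.2, le_rfl⟩
  simp only [g, f, Real.toNNReal_coe, Complex.ofReal_zero, zero_mul, Complex.exp_zero, one_smul,
    Real.toNNReal_zero, hT.map_zero, ContinuousLinearMap.id_apply] at h
  rw [eq_comm, ← h, smul_smul, ← Complex.exp_add, h]
  simp

/-- The generator forces the action on each `b i`, and these vectors span a dense subspace. -/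
theorem IsDiagonal.isSemigroupOf_unique (hL : IsDiagonal L b lam) {S T : ℝ≥0 → H →L[ℂ] H}
    (hS : IsSemigroupOf L S) (hT : IsSemigroupOf L T) : S = T := by
  funext t
  refine ContinuousLinearMap.ext_on (s := Set.range b) ?_ ?_
  · exact Submodule.dense_iff_topologicalClosure_eq_top.2 b.dense_span
  · rintro _ ⟨i, rfl⟩
    rw [hS.apply_eigenvector (hL.smul_basis_mem_graph i),
      hT.apply_eigenvector (hL.smul_basis_mem_graph i)]

theorem IsSemigroupOf.inner_basis {T : ℝ≥0 → H →L[ℂ] H} (hT : IsSemigroupOf L T)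
    (hL : IsDiagonal L b lam) (t : ℝ≥0) (x : H) (i : ι) :
    ⟪b i, T t x⟫_ℂ = (Real.exp (-(t * lam i)) : ℝ) * ⟪b i, x⟫_ℂ := by
  have h : (innerSL ℂ (b i)).comp (T t) =
      ((Real.exp (-(t * lam i)) : ℝ) : ℂ) • innerSL ℂ (b i) := by
    refine ContinuousLinearMap.ext_on (s := Set.range b)
      (Submodule.dense_iff_topologicalClosure_eq_top.2 b.dense_span) ?_
    rintro _ ⟨j, rfl⟩
    rw [ContinuousLinearMap.comp_apply, hT.apply_eigenvector (hL.smul_basis_mem_graph j)]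
    obtain rfl | hij := eq_or_ne i j
    · simp
    · simp [inner_basis_of_ne b hij]
  simpa using congr($h x)

theorem isTraceClass_of_diagonal [CompleteSpace H] (b : HilbertBasis ι ℂ H) {D : H →L[ℂ] H}
    {d : ι → ℝ} (hd0 : ∀ i, 0 ≤ d i) (hd : Summable d)
    (hD : ∀ x i, ⟪b i, D x⟫_ℂ = (d i : ℂ) * ⟪b i, x⟫_ℂ) : IsTraceClass D := by
  have hD' : ∀ x i, ⟪D x, b i⟫_ℂ = (d i : ℂ) * ⟪x, b i⟫_ℂ := fun x i => by
    rw [← inner_conj_symm, hD, map_mul, Complex.conj_ofReal, inner_conj_symm]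
  have hsymm : (D : H →ₗ[ℂ] H).IsSymmetric := fun x y => by
    change ⟪D x, y⟫_ℂ = ⟪x, D y⟫_ℂ
    refine (b.hasSum_inner_mul_inner (D x) y).unique ?_
    convert b.hasSum_inner_mul_inner x (D y) using 2 with i
    rw [hD, hD']
    ring
  have hsum : ∀ x, HasSum (fun i => d i * ‖⟪b i, x⟫_ℂ‖ ^ 2) (⟪D x, x⟫_ℂ).re := fun x => by
    convert! Complex.reCLM.hasSum (b.hasSum_inner_mul_inner (D x) x) using 2 with i
    rw [hD', mul_assoc, ← inner_conj_symm x (b i), ← Complex.normSq_eq_conj_mul_self,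
      ← Complex.ofReal_mul, Complex.normSq_eq_norm_sq, Complex.reCLM_apply, Complex.ofReal_re]
  have hpos : 0 ≤ D := by
    rw [ContinuousLinearMap.nonneg_iff_isPositive, ContinuousLinearMap.isPositive_def]
    exact ⟨hsymm, fun x => (hsum x).nonneg fun i => mul_nonneg (hd0 i) (by positivity)⟩
  intro s e
  rw [CFC.abs_of_nonneg D hpos]
  -- Parseval in the basis `e` makes the sum over `j` equal to `d i`; Tonelli then lets the order of
  -- summation be exchanged, so the choice of `e` is immaterial.
  have hprod : Summable fun p : ι × s => d p.1 * ‖⟪b p.1, e p.2⟫_ℂ‖ ^ 2 := by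
    have hrow : ∀ i, HasSum (fun j : s => d i * ‖⟪b i, e j⟫_ℂ‖ ^ 2) (d i) := fun i => by
      have h := (hasSum_norm_inner_sq e (b i)).mul_left (d i)
      simpa [b.orthonormal.1 i, norm_inner_symm] using h
    rw [summable_prod_of_nonneg fun p => mul_nonneg (hd0 _) (by positivity)]
    refine ⟨fun i => (hrow i).summable, ?_⟩
    simpa only [(hrow _).tsum_eq] using hd
  refine hprod.prod_symm.prod.congr fun j => ?_
  exact (hsum (e j)).tsum_eq

/-- Combines `min(t,1)(1+λ) ≤ 1 + tλ ≤ e^{tλ}` with comparison. -/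
theorem summable_exp_neg_mul {ι : Type*} {lam : ι → ℝ} (h0 : ∀ i, 0 ≤ lam i)
    (hs : Summable fun i => (1 + lam i)⁻¹) {t : ℝ} (ht : 0 < t) :
    Summable fun i => Real.exp (-(t * lam i)) := by
  refine Summable.of_nonneg_of_le (fun i => Real.exp_nonneg _) (fun i => ?_)
    (hs.mul_left (min t 1)⁻¹)
  have hm : 0 < min t 1 := lt_min ht one_pos
  have h1 : 0 < 1 + lam i := by linarith [h0 i]
  rw [← mul_inv, Real.exp_neg]
  gcongr
  have h2 := Real.add_one_le_exp (t * lam i)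
  have h3 : min t 1 * lam i ≤ t * lam i :=
    mul_le_mul_of_nonneg_right (min_le_left _ _) (h0 i)
  have h4 : min t 1 ≤ 1 := min_le_right _ _
  linarith

theorem finite_setOf_le_of_summable {ι : Type*} {lam : ι → ℝ} (h0 : ∀ i, 0 ≤ lam i)
    (hs : Summable fun i => (1 + lam i)⁻¹) (R : ℝ) : {i | lam i ≤ R}.Finite := by
  have hR : 0 < (1 + |R|)⁻¹ := by positivity
  have h := hs.tendsto_cofinite_zero.eventually (gt_mem_nhds hR)
  refine (Filter.eventually_cofinite.1 h).subset fun i hi => ?_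
  have h1 : 0 < 1 + lam i := by linarith [h0 i]
  rw [Set.mem_ofPred_eq, not_lt]
  gcongr
  exact le_trans hi (le_abs_self R)

/-- Only finitely many indices have `lam i` below a given bound, so every `z` has positive distance
to the eigenvalues other than `z`. This isolates eigenvalues, and for any other `z` it bounds the
diagonal inverse of `L - z`. -/
theorem IsDiagonal.hasPurelyDiscreteSpectrum (hL : IsDiagonal L b lam) (h0 : ∀ i, 0 ≤ lam i)
    (hs : Summable fun i => (1 + lam i)⁻¹) : HasPurelyDiscreteSpectrum L := by
  have hgap : ∀ z : ℂ, ∃ ε : ℝ, 0 < ε ∧ ∀ i, (lam i : ℂ) ≠ z → ε ≤ ‖(lam i : ℂ) - z‖ := by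
    intro z
    have h1 : ∀ᶠ ε : ℝ in 𝓝[>] 0, ∀ i ∈ {i | lam i ≤ ‖z‖ + 1},
        (lam i : ℂ) ≠ z → ε ≤ ‖(lam i : ℂ) - z‖ := by
      rw [Filter.eventually_all_finite (finite_setOf_le_of_summable h0 hs _)]
      intro i _
      by_cases hi : (lam i : ℂ) = z
      · simp [hi]
      · filter_upwards [nhdsWithin_le_nhds
          (ge_mem_nhds (norm_pos_iff.2 (sub_ne_zero.2 hi)))] with ε hε _ using hε
    have h2 : ∀ᶠ ε : ℝ in 𝓝[>] 0, ε < 1 := nhdsWithin_le_nhds (gt_mem_nhds one_pos)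
    obtain ⟨ε, ⟨hε, hε1⟩, hε0⟩ := ((h1.and h2).and self_mem_nhdsWithin).exists
    refine ⟨ε, hε0, fun i hi => ?_⟩
    -- Eigenvalues beyond `‖z‖ + 1` are at distance greater than `1 > ε` from `z`.
    by_cases hi' : lam i ≤ ‖z‖ + 1
    · exact hε i hi' hi
    · have h3 := norm_sub_norm_le (lam i : ℂ) z
      rw [Complex.norm_real, Real.norm_of_nonneg (h0 i)] at h3
      linarith
  have hspec : ∀ z ∈ operatorSpectrum L, ∃ i, (lam i : ℂ) = z := by
    intro z hz
    by_contra! hne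
    refine hz ?_
    obtain ⟨ε, hε, hgapz⟩ := hgap z
    obtain ⟨R, hR⟩ := exists_diagonal b (fun i => ((lam i : ℂ) - z)⁻¹) ε⁻¹ fun i => by
      rw [norm_inv]
      exact inv_anti₀ hε (hgapz i (hne i))
    have hne' : ∀ i, (lam i : ℂ) - z ≠ 0 := fun i => sub_ne_zero.2 (hne i)
    refine ⟨R, fun f => ?_, fun u => ?_⟩
    · have h1 : (R f, f + z • R f) ∈ L.graph := by
        rw [hL]
        intro i
        rw [inner_add_right, inner_smul_right, hR]
        field_simp [hne' i]
        ring
      obtain ⟨y, hy, hy'⟩ := (LinearPMap.mem_graph_iff L).1 h1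
      obtain ⟨y, hyL⟩ := y
      obtain rfl : y = R f := hy
      refine ⟨hyL, ?_⟩
      rw [hy']
      simp
    · have h1 := (hL _ _).1 (L.mem_graph u)
      refine ext_inner_basis b fun i => ?_
      rw [hR, inner_sub_right, inner_smul_right, h1, ← sub_mul, inv_mul_cancel_left₀ (hne' i)]
  intro z hz
  obtain ⟨i, rfl⟩ := hspec z hz
  refine ⟨?_, ?_, ?_⟩
  · obtain ⟨ε, hε, h⟩ := hgap (lam i)
    refine ⟨ε, hε, fun w hw hwz => ?_⟩
    obtain ⟨j, rfl⟩ := hspec w hw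
    rw [dist_eq_norm]
    exact h j hwz
  · refine (Submodule.ne_bot_iff _).2 ⟨b i, hL.smul_basis_mem_graph i, ?_⟩
    exact b.orthonormal.ne_zero i
  · have hfin : {j | lam j = lam i}.Finite :=
      (finite_setOf_le_of_summable h0 hs (lam i)).subset fun j hj => le_of_eq hj
    have : FiniteDimensional ℂ (Submodule.span ℂ (b '' {j | lam j = lam i})) :=
      FiniteDimensional.span_of_finite ℂ (hfin.image b)
    refine Submodule.finiteDimensional_of_le
      (S₂ := Submodule.span ℂ (b '' {j | lam j = lam i})) fun x hx => ?_
    -- An eigenvector has zero coefficient wherever `lam j ≠ lam i`, so its expansion is a finite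
    -- sum.
    have hx' : ∀ j, j ∉ hfin.toFinset → b.repr x j • b j = 0 := fun j hj => by
      have h1 := (hL _ _).1 hx j
      rw [inner_smul_right] at h1
      have h2 : ((lam i : ℂ) - lam j) * ⟪b j, x⟫_ℂ = 0 := by rw [sub_mul, h1, sub_self]
      rw [b.repr_apply_apply, (mul_eq_zero.1 h2).resolve_left, zero_smul]
      rw [sub_eq_zero, Complex.ofReal_inj, eq_comm]
      simpa using hj
    rw [(b.hasSum_repr x).unique (hasSum_sum_of_ne_finset_zero hx')]
    refine Submodule.sum_mem _ fun j hj => Submodule.smul_mem _ _ (Submodule.subset_span ?_)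
    exact ⟨j, by simpa using hj, rfl⟩

end Diagonal

/-! ### Pointwise evaluation and compactness in the weighted space. -/

section WeightedSpace

universe u

variable {X : Type u} [MeasurableSpace X] {m : X → ℝ}

theorem integrable_norm_sq (u : Ell2 m) : Integrable (fun x => ‖u x‖ ^ 2) (weightMeasure m) :=
  (Lp.memLp u).norm.integrable_sq

theorem norm_sq_eq_integral (u : Ell2 m) : ‖u‖ ^ 2 = ∫ x, ‖u x‖ ^ 2 ∂weightMeasure m := by
  have h := L2.inner_def (𝕜 := ℂ) u u
  simp only [inner_self_eq_norm_sq_to_K] at h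
  have h' : ((‖u‖ ^ 2 : ℝ) : ℂ) = ((∫ x, ‖u x‖ ^ 2 ∂weightMeasure m : ℝ) : ℂ) := by
    rw [← integral_complex_ofReal]
    simpa using h
  exact_mod_cast h'

variable [DiscreteMeasurableSpace X]

theorem weightMeasure_singleton (x : X) : weightMeasure m {x} = ENNReal.ofReal (m x) := by
  rw [weightMeasure, Measure.sum_apply _ (measurableSet_singleton x), tsum_eq_single x]
  · simp
  · intro y hy
    simp [hy]

theorem weightMeasure_real_singleton (hm : ∀ x, 0 < m x) (x : X) :
    (weightMeasure m).real {x} = m x := by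
  rw [Measure.real, weightMeasure_singleton, ENNReal.toReal_ofReal (hm x).le]

/-- Every point has positive mass, so only the empty set is null; elements of `Ell2 m` therefore
have well-defined values at points. -/
theorem ae_weightMeasure_iff (hm : ∀ x, 0 < m x) {p : X → Prop} :
    (∀ᵐ x ∂weightMeasure m, p x) ↔ ∀ x, p x := by
  refine ⟨fun h x => ?_, Eventually.of_forall⟩
  by_contra hx
  have h1 : weightMeasure m {x} ≤ weightMeasure m {y | ¬ p y} :=
    measure_mono (Set.singleton_subset_iff.2 hx)
  rw [ae_iff.1 h, weightMeasure_singleton, nonpos_iff_eq_zero, ENNReal.ofReal_eq_zero] at h1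
  exact (hm x).not_ge h1

/-- Evaluation at a point is bounded on `ℓ²`. -/
theorem mul_norm_apply_sq_le (hm : ∀ x, 0 < m x) (u : Ell2 m) (x : X) :
    m x * ‖u x‖ ^ 2 ≤ ‖u‖ ^ 2 := by
  rw [norm_sq_eq_integral, ← weightMeasure_real_singleton hm x, ← smul_eq_mul,
    ← integral_singleton (f := fun x => ‖u x‖ ^ 2)]
  exact setIntegral_le_integral (integrable_norm_sq u)
    (Eventually.of_forall fun _ => by positivity)

/-- Evaluation at a point as a continuous functional on `ℓ²`. -/
theorem exists_evaluation (hm : ∀ x, 0 < m x) (x : X) :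
    ∃ e : Ell2 m →L[ℂ] ℂ, ∀ u, e u = u x := by
  let A : Ell2 m →ₗ[ℂ] ℂ :=
    { toFun := fun u => u x
      map_add' := fun u v => (ae_weightMeasure_iff hm).1 (Lp.coeFn_add u v) x
      map_smul' := fun c u => (ae_weightMeasure_iff hm).1 (Lp.coeFn_smul c u) x }
  refine ⟨A.mkContinuous (√(m x))⁻¹ fun u => ?_, fun u => rfl⟩
  rw [le_inv_mul_iff₀ (Real.sqrt_pos.2 (hm x)),
    ← pow_le_pow_iff_left₀ (by positivity) (norm_nonneg _) two_ne_zero, mul_pow,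
    Real.sq_sqrt (hm x).le]
  exact mul_norm_apply_sq_le hm u x

theorem coeFn_sum_smul_apply (hm : ∀ x, 0 < m x) {ι : Type*} (F : Finset ι) (c : ι → ℂ)
    (u : ι → Ell2 m) (x : X) : (∑ i ∈ F, c i • u i : Ell2 m) x = ∑ i ∈ F, c i * u i x := by
  obtain ⟨e, he⟩ := exists_evaluation hm x
  simp only [← he, map_sum, map_smul, smul_eq_mul]

/-- An operator into `ℓ²` of a finite measure space that maps boundedly into `ℓ^∞` is compact. -/
theorem isCompactOperator_of_sup_bound [Countable X] (hm : ∀ x, 0 < m x)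
    [IsFiniteMeasure (weightMeasure m)]
    {V : Type*} [NormedAddCommGroup V] [NormedSpace ℂ V] (J : V →L[ℂ] Ell2 m) {C : ℝ} (hC : 0 ≤ C)
    (hJ : ∀ v x, ‖J v x‖ ≤ C * ‖v‖) : IsCompactOperator J := by
  classical
  choose e he using exists_evaluation hm
  let δ : X → Ell2 m := fun x =>
    indicatorConstLp 2 (measurableSet_singleton x) (measure_ne_top _ _) (1 : ℂ)
  have hδ : ∀ x y, δ x y = if y = x then 1 else 0 := fun x y => by
    have h := (ae_weightMeasure_iff hm).1 (indicatorConstLp_coeFn (p := 2)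
      (hs := measurableSet_singleton x) (hμs := measure_ne_top (weightMeasure m) _)
      (c := (1 : ℂ))) y
    simpa [Set.indicator_apply] using h
  -- Finite-rank truncation: `A F v` is `J v` cut off outside `F`.
  let A : Finset X → V →L[ℂ] Ell2 m := fun F => ∑ x ∈ F, ((e x).comp J).smulRight (δ x)
  have hA : ∀ F v x, A F v x = if x ∈ F then J v x else 0 := fun F v x => by
    have : A F v = ∑ y ∈ F, J v y • δ y := by
      simp [A, he]
    rw [this, coeFn_sum_smul_apply hm]
    simp [hδ]
  have hAc : ∀ F, IsCompactOperator (A F) := fun F => by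
    have : A F ∈ compactOperator (RingHom.id ℂ) V (Ell2 m) := by
      refine Submodule.sum_mem _ fun x _ => ?_
      exact (isCompactOperator_of_locallyCompactSpace_dom ((e x).comp J)).continuous_comp
        (g := fun c : ℂ => c • δ x) (by fun_prop)
    exact this
  have hbound : ∀ F, ‖A F - J‖ ≤ C * √((weightMeasure m).real (F : Set X)ᶜ) := fun F => by
    refine ContinuousLinearMap.opNorm_le_bound _ (by positivity) fun v => ?_
    rw [← pow_le_pow_iff_left₀ (norm_nonneg _) (by positivity) two_ne_zero, norm_sq_eq_integral,
      mul_pow, mul_pow, Real.sq_sqrt measureReal_nonneg]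
    have h1 : ∀ x, ‖(A F - J) v x‖ ^ 2 ≤
        (F : Set X)ᶜ.indicator (fun _ => C ^ 2 * ‖v‖ ^ 2) x := fun x => by
      have h2 : (A F - J) v x = A F v x - J v x :=
        (ae_weightMeasure_iff hm).1 (Lp.coeFn_sub (A F v) (J v)) x
      rw [h2, hA]
      by_cases hx : x ∈ F
      · simp [hx]
      · have h3 := hJ v x
        simp only [hx, if_false, zero_sub, norm_neg, Set.indicator_apply, Set.mem_compl_iff,
          Finset.mem_coe, not_false_eq_true, if_true]
        rw [← mul_pow]
        gcongr
    refine (integral_mono (integrable_norm_sq _)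
      ((integrable_const _).indicator (F : Set X).toFinite.measurableSet.compl) h1).trans ?_
    rw [integral_indicator_const _ (F : Set X).toFinite.measurableSet.compl, smul_eq_mul]
    exact le_of_eq (by ring)
  -- Continuity from above of the finite measure, as the complements of finite sets decrease to `∅`.
  have hlim : Tendsto (fun F : Finset X => C * √((weightMeasure m).real (F : Set X)ᶜ)) atTop
      (𝓝 0) := by
    have h1 : Tendsto (weightMeasure m ∘ fun F : Finset X => (F : Set X)ᶜ) atTop
        (𝓝 (weightMeasure m (⋂ F : Finset X, (F : Set X)ᶜ))) := by
      refine tendsto_measure_iInter_atTop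
        (fun F => (F : Set X).toFinite.measurableSet.compl.nullMeasurableSet)
        (fun F G h => Set.compl_subset_compl.2 (Finset.coe_subset.2 h)) ⟨∅, measure_ne_top _ _⟩
    have h2 : (⋂ F : Finset X, (F : Set X)ᶜ) = ∅ := by
      ext x
      simp only [Set.mem_iInter, Set.mem_compl_iff, Finset.mem_coe, Set.mem_empty_iff_false,
        iff_false, not_forall, not_not]
      exact ⟨{x}, Finset.mem_singleton_self x⟩
    rw [h2, measure_empty] at h1
    have h3 := ((ENNReal.tendsto_toReal ENNReal.zero_ne_top).comp h1).sqrt.const_mul C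
    simpa [Measure.real, Function.comp_def] using h3
  have hlim' : Tendsto A atTop (𝓝 J) :=
    tendsto_iff_norm_sub_tendsto_zero.2
      (squeeze_zero (fun _ => norm_nonneg _) hbound hlim)
  exact isCompactOperator_of_tendsto hlim' (Eventually.of_forall hAc)

end WeightedSpace

/-! ### Spectral theorem for compact symmetric operators. -/

section Eigenbasis

universe u

/-- A compact symmetric operator has a Hilbert basis of eigenvectors. -/
theorem exists_hilbertBasis_eigenvectors {H : Type u} [NormedAddCommGroup H]
    [InnerProductSpace ℂ H] [CompleteSpace H] {G : H →L[ℂ] H} (hG : IsCompactOperator G)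
    (hG' : (G : H →ₗ[ℂ] H).IsSymmetric) :
    ∃ (ι : Type u) (b : HilbertBasis ι ℂ H) (μ : ι → ℂ), ∀ i, G (b i) = μ i • b i := by
  let E : ℂ → Submodule ℂ H := fun μ => Module.End.eigenspace (G : Module.End ℂ H) μ
  have hE : ∀ μ x, x ∈ E μ ↔ G x = μ • x := fun μ x => Module.End.mem_eigenspace_iff
  -- The kernel (`μ = 0`) may be infinite-dimensional, so completeness is derived from closedness.
  have hcomplete : ∀ μ, CompleteSpace (E μ) := fun μ => by
    have h : IsClosed (E μ : Set H) := by
      have : (E μ : Set H) = {x | G x = μ • x} := by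
        ext x
        exact hE μ x
      rw [this]
      exact isClosed_eq G.continuous (continuous_const_smul μ)
    exact h.completeSpace_coe
  choose w e _ using fun μ => exists_hilbertBasis ℂ (E μ)
  let v : (Σ μ, w μ) → H := fun a => (e a.1 a.2 : H)
  have hv : Orthonormal ℂ v :=
    hG'.orthogonalFamily_eigenspaces.orthonormal_sigma_orthonormal fun μ => (e μ).orthonormal
  -- A vector orthogonal to all of `v` is orthogonal to each eigenspace, by expansion in `e μ`; for
  -- compact symmetric `G` such a vector is zero.
  have hspan : (Submodule.span ℂ (Set.range v))ᗮ = ⊥ := by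
    rw [eq_bot_iff, ← ContinuousLinearMap.orthogonalComplement_iSup_eigenspaces_eq_bot hG hG',
      ← Submodule.iInf_orthogonal]
    intro x hx
    rw [Submodule.mem_iInf]
    intro μ y hy
    have h1 := ((e μ).hasSum_repr ⟨y, hy⟩).mapL ((innerSL ℂ x).comp (E μ).subtypeL)
    have h2 : ∀ j, ⟪x, (e μ j : H)⟫_ℂ = 0 := fun j =>
      Submodule.inner_left_of_mem_orthogonal
        (Submodule.subset_span (Set.mem_range_self (⟨μ, j⟩ : Σ μ, w μ))) hx
    have h3 : ⟪x, y⟫_ℂ = 0 := by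
      refine h1.unique ?_
      convert hasSum_zero with j
      simp [h2]
    rw [← inner_conj_symm, h3, map_zero]
  refine ⟨Σ μ, w μ, HilbertBasis.mkOfOrthogonalEqBot hv hspan, Sigma.fst, fun a => ?_⟩
  rw [HilbertBasis.coe_mkOfOrthogonalEqBot]
  exact (hE _ _).1 (e a.1 a.2).2

end Eigenbasis

/-! ### The form domain as a Hilbert space. -/

section Forms

universe u

variable {X : Type u} [MeasurableSpace X] {m : X → ℝ}

namespace QuadForm

theorem IsDirichletForm.energy_nonneg {Q : QuadForm m} (hQ : Q.IsDirichletForm) (u : Q.domain) :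
    0 ≤ Q.energy u := by
  have hC : LipschitzWith 1 fun _ : ℂ => (0 : ℂ) := LipschitzWith.const' 0
  obtain ⟨h, hle⟩ := hQ.contraction _ hC rfl u
  have h0 : hC.compLp rfl (u : Ell2 m) = 0 := by
    refine Lp.ext ((hC.coeFn_compLp rfl (u : Ell2 m)).trans ?_)
    exact (Lp.coeFn_zero ℂ 2 (weightMeasure m)).symm
  have h1 : (⟨_, h⟩ : Q.domain) = 0 := Subtype.ext h0
  rw [h1] at hle
  simpa [energy] using hle

/-- The domain of a form, to be equipped with the form inner product `Q(u, v) + ⟨u, v⟩`. -/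
def FormDomain (Q : QuadForm m) : Type u := Q.domain

noncomputable instance (Q : QuadForm m) : AddCommGroup Q.FormDomain := inferInstanceAs (AddCommGroup Q.domain)

noncomputable instance (Q : QuadForm m) : Module ℂ Q.FormDomain := inferInstanceAs (Module ℂ Q.domain)

/-- The inclusion of the form domain into `ℓ²`. -/
noncomputable def FormDomain.incl (Q : QuadForm m) : Q.FormDomain →ₗ[ℂ] Ell2 m := Q.domain.subtype

/-- The form inner product on the form domain. -/
noncomputable abbrev formCore (Q : QuadForm m) (hQ : ∀ u, 0 ≤ Q.energy u) :
    InnerProductSpace.Core ℂ Q.FormDomain where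
  inner u v := Q.form u v + ⟪FormDomain.incl Q u, FormDomain.incl Q v⟫_ℂ
  conj_inner_symm u v := by
    rw [map_add, inner_conj_symm]
    congr 1
    exact Q.hermitian v u
  re_inner_nonneg u := by
    rw [map_add]
    exact add_nonneg (hQ u) inner_self_nonneg
  add_left u v w := by
    rw [map_add, inner_add_left]
    have h : ∀ u v w : Q.domain, Q.form (u + v) w = Q.form u w + Q.form v w := fun u v w => by
      rw [map_add, LinearMap.add_apply]
    refine (congr_arg (· + _) (h u v w)).trans ?_
    ring
  smul_left u v c := by
    rw [map_smul, inner_smul_left]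
    have h : ∀ u v : Q.domain, Q.form (c • u) v = conj c * Q.form u v := fun u v => by
      rw [LinearMap.map_smulₛₗ, LinearMap.smul_apply, smul_eq_mul]
    refine (congr_arg (· + _) (h u v)).trans ?_
    ring
  definite u hu := by
    have h1 : Q.energy u + ‖FormDomain.incl Q u‖ ^ 2 = 0 := by
      have := congr_arg Complex.re hu
      rw [Complex.add_re] at this
      simpa [energy, ← inner_self_eq_norm_sq (𝕜 := ℂ)] using this
    have h2 : ‖FormDomain.incl Q u‖ ^ 2 = 0 := by
      linarith [hQ u, sq_nonneg ‖FormDomain.incl Q u‖]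
    exact Subtype.ext (norm_eq_zero.1 (pow_eq_zero_iff two_ne_zero |>.1 h2))

/-- The domain of a nonnegative closed form is a Hilbert space for the form inner product. -/
theorem IsClosedForm.exists_formSpace {Q : QuadForm m} (hQ : Q.IsClosedForm)
    (hQ0 : ∀ u, 0 ≤ Q.energy u) :
    ∃ (V : Type u) (_ : NormedAddCommGroup V) (_ : InnerProductSpace ℂ V) (_ : CompleteSpace V)
      (J : V →L[ℂ] Ell2 m) (hJ : ∀ v, J v ∈ Q.domain), (∀ u ∈ Q.domain, ∃ v, J v = u) ∧
      ∀ v w, ⟪v, w⟫_ℂ = Q.form ⟨J v, hJ v⟩ ⟨J w, hJ w⟩ + ⟪J v, J w⟫_ℂ := by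
  let _ : NormedAddCommGroup Q.FormDomain := (formCore Q hQ0).toNormedAddCommGroup
  let _ : InnerProductSpace ℂ Q.FormDomain := InnerProductSpace.ofCore _
  have hinner : ∀ v w : Q.FormDomain, ⟪v, w⟫_ℂ =
    Q.form v w + ⟪FormDomain.incl Q v, FormDomain.incl Q w⟫_ℂ := fun v w => rfl
  have hnorm : ∀ v : Q.FormDomain, ‖v‖ ^ 2 = Q.energy v + ‖FormDomain.incl Q v‖ ^ 2 := fun v => by
    rw [← inner_self_eq_norm_sq (𝕜 := ℂ), hinner, map_add, inner_self_eq_norm_sq]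
    rfl
  have hle : ∀ v : Q.FormDomain, ‖FormDomain.incl Q v‖ ≤ 1 * ‖v‖ := fun v => by
    rw [one_mul, ← pow_le_pow_iff_left₀ (norm_nonneg _) (norm_nonneg _) two_ne_zero, hnorm]
    linarith [hQ0 v]
  let J : Q.FormDomain →L[ℂ] Ell2 m := (FormDomain.incl Q).mkContinuous 1 hle
  have hcomplete : CompleteSpace Q.FormDomain := by
    refine Metric.complete_of_cauchySeq_tendsto fun u hu => ?_
    -- A sequence Cauchy in the form norm is Cauchy both in `ℓ²` and for `Q`, so closedness supplies
    -- the limit.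
    obtain ⟨v, hv⟩ := cauchySeq_tendsto_of_complete (J.uniformContinuous.comp_cauchySeq hu)
    have h0 : Tendsto (fun p : ℕ × ℕ => ‖u p.1 - u p.2‖ ^ 2) atTop (𝓝 0) := by
      have := (cauchySeq_iff_tendsto_dist_atTop_0.1 hu).pow 2
      simpa [dist_eq_norm] using this
    have h1 : Tendsto (fun p : ℕ × ℕ => Q.energy (u p.1 - u p.2 : Q.FormDomain)) atTop (𝓝 0) := by
      refine squeeze_zero (fun p => hQ0 _) (fun p => ?_) h0
      rw [hnorm]
      exact le_add_of_nonneg_right (by positivity)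
    obtain ⟨hvQ, h2⟩ := hQ u v hv h1
    let v' : Q.FormDomain := (⟨v, hvQ⟩ : Q.domain)
    refine ⟨v', ?_⟩
    rw [tendsto_iff_norm_sub_tendsto_zero]
    have h3 : Tendsto (fun n => ‖u n - v'‖ ^ 2) atTop (𝓝 0) := by
      have h4 := (tendsto_iff_norm_sub_tendsto_zero.1 hv).pow 2
      have h5 := h2.add h4
      rw [zero_pow two_ne_zero, add_zero] at h5
      exact h5.congr fun n => (hnorm (u n - v')).symm
    simpa using h3.sqrt
  exact ⟨Q.FormDomain, _, _, hcomplete, J, fun v => v.2, fun u hu => ⟨⟨u, hu⟩, rfl⟩, hinner⟩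

end QuadForm

variable [DiscreteMeasurableSpace X]

/-- This makes point evaluations uniformly bounded in the form norm: the term `α|u(o)|²` is absorbed
through `|u(o)|² ≤ m(o)⁻¹‖u‖²`. -/
theorem QuadForm.SatisfiesSobolev.exists_bound {Q : QuadForm m} (hm : ∀ x, 0 < m x) {α : ℝ}
    (hα : 0 ≤ α) {o : X} (hS : Q.SatisfiesSobolev ⊤ α o) (hQ0 : ∀ u, 0 ≤ Q.energy u) :
    ∃ C : ℝ, 0 ≤ C ∧ ∀ (u : Q.domain) (x : X),
      ‖(u : Ell2 m) x‖ ^ 2 ≤ C ^ 2 * (Q.energy u + ‖(u : Ell2 m)‖ ^ 2) := by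
  obtain ⟨S, hS⟩ := hS
  -- The factor `1 + α/m(o)` dominates both the coefficient `1` of the energy and `α/m(o)` of
  -- `‖u‖²`; `S` itself could be negative.
  refine ⟨√(|S| * (1 + α * (m o)⁻¹)), Real.sqrt_nonneg _, fun u x => ?_⟩
  have hmo := hm o
  rw [Real.sq_sqrt (by positivity)]
  have h1 : ‖(u : Ell2 m) x‖ₑ ^ 2 ≤
      ENNReal.ofReal (S * (Q.energy u + α * ‖(u : Ell2 m) o‖ ^ 2)) := by
    refine le_trans ?_ (hS u)
    gcongr
    rw [eLpNorm_exponent_top]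
    exact (ae_weightMeasure_iff hm).1 (ae_le_eLpNormEssSup (f := ((u : Ell2 m) : X → ℂ))) x
  have h2 : ‖(u : Ell2 m) o‖ ^ 2 ≤ (m o)⁻¹ * ‖(u : Ell2 m)‖ ^ 2 := by
    rw [le_inv_mul_iff₀ hmo]
    exact mul_norm_apply_sq_le hm u o
  have h3 : 0 ≤ Q.energy u + α * ‖(u : Ell2 m) o‖ ^ 2 := by
    have := hQ0 u
    positivity
  have h4 : ‖(u : Ell2 m) x‖ ^ 2 ≤ |S| * (Q.energy u + α * ‖(u : Ell2 m) o‖ ^ 2) := by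
    rw [← ofReal_norm, ← ENNReal.ofReal_pow (norm_nonneg _)] at h1
    refine (ENNReal.ofReal_le_ofReal_iff (by positivity)).1 (h1.trans ?_)
    gcongr
    exact le_abs_self S
  refine h4.trans ?_
  rw [mul_assoc]
  gcongr
  have h5 : α * ‖(u : Ell2 m) o‖ ^ 2 ≤ α * ((m o)⁻¹ * ‖(u : Ell2 m)‖ ^ 2) := by gcongr
  have h6 : 0 ≤ α * (m o)⁻¹ * Q.energy u := mul_nonneg (by positivity) (hQ0 u)
  nlinarith [sq_nonneg ‖(u : Ell2 m)‖]

end Forms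

/-! ### Trace bound for `J J*` and diagonalization of the generator. -/

open ContinuousLinearMap in
/-- The eigenvalues of `J J*` are summable if `J` maps boundedly into `ℓ^∞` of a finite measure
space. -/
theorem summable_eigenvalues_of_sup_bound {X : Type*} [MeasurableSpace X]
    [DiscreteMeasurableSpace X] {m : X → ℝ} (hm : ∀ x, 0 < m x) [IsFiniteMeasure (weightMeasure m)]
    {V : Type*} [NormedAddCommGroup V] [InnerProductSpace ℂ V] [CompleteSpace V]
    {J : V →L[ℂ] Ell2 m} {C : ℝ} (hJ : ∀ v x, ‖J v x‖ ≤ C * ‖v‖)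
    {ι : Type*} (b : HilbertBasis ι ℂ (Ell2 m)) {μ : ι → ℝ} (hμ0 : ∀ i, 0 ≤ μ i)
    (hμ : ∀ i, J (adjoint J (b i)) = (μ i : ℂ) • b i) : Summable μ := by
  classical
  refine summable_of_sum_le (c := C ^ 2 * (weightMeasure m).real Set.univ) hμ0 fun F => ?_
  have hinner : ∀ i j, ⟪adjoint J (b i), adjoint J (b j)⟫_ℂ = if i = j then (μ j : ℂ) else 0 :=
    fun i j => by
      rw [adjoint_inner_left, hμ, inner_smul_right,
        orthonormal_iff_ite.1 b.orthonormal i j]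
      simp
  have hpt : ∀ x, ∑ i ∈ F, μ i * ‖b i x‖ ^ 2 ≤ C ^ 2 := fun x => by
    set s := ∑ i ∈ F, μ i * ‖b i x‖ ^ 2 with hs
    have hs0 : 0 ≤ s := Finset.sum_nonneg fun i _ => mul_nonneg (hμ0 i) (by positivity)
    -- Chosen as the part along the `J* bᵢ`, `i ∈ F`, of the Riesz representer of `v ↦ J v x`, so
    -- that `J v x = ‖v‖² = s`. The sup bound then reads `s² ≤ C² s`.
    let v : V := ∑ i ∈ F, conj (b i x) • adjoint J (b i)
    have hterm : ∀ i, conj (b i x) * ((μ i : ℂ) * b i x) = ((μ i * ‖b i x‖ ^ 2 : ℝ) : ℂ) :=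
      fun i => by
        rw [mul_left_comm, ← Complex.normSq_eq_conj_mul_self, Complex.normSq_eq_norm_sq]
        push_cast
        rfl
    have hv : ‖v‖ ^ 2 = s := by
      have : ⟪v, v⟫_ℂ = (s : ℂ) := by
        simp only [v, sum_inner, inner_sum, inner_smul_left, inner_smul_right, hinner]
        simp only [mul_ite, mul_zero, Finset.sum_ite_eq', Complex.conj_conj]
        rw [hs, Complex.ofReal_sum]
        refine Finset.sum_congr rfl fun i hi => ?_
        rw [if_pos hi, ← hterm]
        ring
      rw [← inner_self_eq_norm_sq (𝕜 := ℂ), this]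
      simp
    have hJv : J v x = (s : ℂ) := by
      have : J v = ∑ i ∈ F, (conj (b i x) * (μ i : ℂ)) • b i := by
        simp only [v, map_sum, map_smul, hμ, smul_smul]
      rw [this, coeFn_sum_smul_apply hm, hs, Complex.ofReal_sum]
      refine Finset.sum_congr rfl fun i _ => ?_
      rw [← hterm, mul_assoc]
    have h1 := hJ v x
    rw [hJv, Complex.norm_real, Real.norm_of_nonneg hs0] at h1
    have h2 : s ^ 2 ≤ C ^ 2 * s := by
      rw [← hv, ← mul_pow, hv]
      gcongr
    rcases hs0.eq_or_lt with h | h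
    · rw [← h]
      positivity
    · exact le_of_mul_le_mul_right (by rwa [← sq]) h
  have hint : ∑ i ∈ F, μ i = ∫ x, ∑ i ∈ F, μ i * ‖b i x‖ ^ 2 ∂weightMeasure m := by
    rw [integral_finsetSum _ fun i _ => (integrable_norm_sq (b i)).const_mul (μ i)]
    refine Finset.sum_congr rfl fun i _ => ?_
    rw [integral_const_mul, ← norm_sq_eq_integral, b.orthonormal.1 i]
    simp
  rw [hint]
  refine (integral_mono (integrable_finsetSum _ fun i _ =>
    (integrable_norm_sq (b i)).const_mul (μ i)) (integrable_const (C ^ 2)) hpt).trans ?_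
  rw [integral_const, smul_eq_mul, mul_comm]

universe u in
open ContinuousLinearMap in
/-- The generator of a Dirichlet form with an `ℓ^∞`-Sobolev inequality is diagonal in a Hilbert
basis, and its resolvent has summable eigenvalues. -/
theorem QuadForm.exists_isDiagonal_generator {X : Type u} [Countable X] [MeasurableSpace X]
    [DiscreteMeasurableSpace X] {m : X → ℝ} (hm : ∀ x, 0 < m x) [IsFiniteMeasure (weightMeasure m)]
    {Q : QuadForm m} (hQ : Q.IsDirichletForm) {α : ℝ} (hα : 0 ≤ α) {o : X}
    (hS : Q.SatisfiesSobolev ⊤ α o) :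
    ∃ (ι : Type u) (b : HilbertBasis ι ℂ (Ell2 m)) (lam : ι → ℝ), IsDiagonal Q.generator b lam ∧
      (∀ i, 0 ≤ lam i) ∧ Summable fun i => (1 + lam i)⁻¹ := by
  obtain ⟨V, _, _, _, J, hJQ, hJsurj, hinner⟩ := hQ.closed.exists_formSpace hQ.energy_nonneg
  obtain ⟨C, hC, hCb⟩ := hS.exists_bound hm hα hQ.energy_nonneg
  have hnorm : ∀ v, ‖v‖ ^ 2 = Q.energy ⟨J v, hJQ v⟩ + ‖J v‖ ^ 2 := fun v => by
    rw [← inner_self_eq_norm_sq (𝕜 := ℂ), hinner, map_add, inner_self_eq_norm_sq]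
    rfl
  have hJC : ∀ v x, ‖J v x‖ ≤ C * ‖v‖ := fun v x => by
    rw [← pow_le_pow_iff_left₀ (norm_nonneg _) (by positivity) two_ne_zero, mul_pow, hnorm]
    exact hCb ⟨J v, hJQ v⟩ x
  have hJ1 : ‖J‖ ≤ 1 := opNorm_le_bound _ zero_le_one fun v => by
    rw [one_mul, ← pow_le_pow_iff_left₀ (norm_nonneg _) (norm_nonneg _) two_ne_zero, hnorm]
    exact le_add_of_nonneg_left (hQ.energy_nonneg _)
  have hcomp : IsCompactOperator (J ∘L adjoint J) :=
    (isCompactOperator_of_sup_bound hm J hC hJC).comp_clm (adjoint J)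
  have hpos : (J ∘L adjoint J).IsPositive := isPositive_self_comp_adjoint J
  obtain ⟨ι, b, μ', hμ'⟩ := exists_hilbertBasis_eigenvectors hcomp hpos.isSymmetric
  -- This form shows that the eigenvalues are real and nonnegative.
  let μ : ι → ℝ := fun i => ‖adjoint J (b i)‖ ^ 2
  have hμ : ∀ i, J (adjoint J (b i)) = (μ i : ℂ) • b i := fun i => by
    have h1 : J (adjoint J (b i)) = μ' i • b i := hμ' i
    have h2 : ⟪adjoint J (b i), adjoint J (b i)⟫_ℂ = μ' i := by
      rw [adjoint_inner_left, h1, inner_smul_right, inner_basis_self, mul_one]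
    rw [inner_self_eq_norm_sq_to_K] at h2
    rw [h1, ← h2]
    simp [μ]
  -- The range of `J` is `D(Q)`, which is dense, so `J*` is injective and no eigenvalue vanishes.
  have hinj : ∀ f, adjoint J f = 0 → f = 0 := fun f hf => by
    refine hQ.dense.eq_zero_of_inner_left (𝕜 := ℂ) fun u hu => ?_
    obtain ⟨v, rfl⟩ := hJsurj u hu
    rw [← adjoint_inner_left, hf, inner_zero_left]
  have hμpos : ∀ i, 0 < μ i := fun i => by
    have : adjoint J (b i) ≠ 0 := fun h => b.orthonormal.ne_zero i (hinj _ h)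
    positivity
  have hμ1 : ∀ i, μ i ≤ 1 := fun i => by
    refine pow_le_one₀ (norm_nonneg _) ((le_opNorm _ _).trans ?_)
    rw [b.orthonormal.1 i, mul_one, LinearIsometryEquiv.norm_map]
    exact hJ1
  -- This is `J J* = (L+1)⁻¹`: for `u = Jv`, the relation `Q(u,·) = ⟨w,·⟩` says that `v` represents
  -- `⟨u+w, J·⟩` in the form inner product, i.e. `v = J*(u+w)`.
  have hgraph : ∀ u w, (u, w) ∈ Q.generator.graph ↔ J (adjoint J (u + w)) = u := fun u w => by
    rw [Q.generator_graph hQ.dense]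
    constructor
    · rintro ⟨hu, h⟩
      obtain ⟨v, rfl⟩ := hJsurj u hu
      congr 1
      refine ext_inner_right ℂ fun v' => ?_
      rw [adjoint_inner_left, hinner, inner_add_left, add_comm]
      congr 1
      exact (h ⟨J v', hJQ v'⟩).symm
    · intro h
      refine ⟨h ▸ hJQ _, fun v' => ?_⟩
      obtain ⟨v', hv'⟩ := v'
      obtain ⟨v', rfl⟩ := hJsurj v' hv'
      have h1 := hinner (adjoint J (u + w)) v'
      rw [adjoint_inner_left, inner_add_left] at h1
      simp only [h] at h1
      rw [add_comm] at h1
      exact (add_right_cancel h1).symm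
  have hcoef : ∀ f i, ⟪b i, J (adjoint J f)⟫_ℂ = (μ i : ℂ) * ⟪b i, f⟫_ℂ := fun f i => by
    rw [← adjoint_inner_left, adjoint_inner_right, hμ, inner_smul_left,
      Complex.conj_ofReal]
  -- Solving `μ = (1+λ)⁻¹` for `λ`; the bound `μ i ≤ 1` gives `λ ≥ 0`.
  refine ⟨ι, b, fun i => (μ i)⁻¹ - 1, fun u w => ?_, fun i => ?_, ?_⟩
  · have hiff : ∀ i, ⟪b i, J (adjoint J (u + w))⟫_ℂ = ⟪b i, u⟫_ℂ ↔
        ⟪b i, w⟫_ℂ = (((μ i)⁻¹ - 1 : ℝ) : ℂ) * ⟪b i, u⟫_ℂ := fun i => by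
      have h0 : (μ i : ℂ) ≠ 0 := Complex.ofReal_ne_zero.2 (hμpos i).ne'
      rw [hcoef, inner_add_right, ← eq_inv_mul_iff_mul_eq₀ h0, ← eq_sub_iff_add_eq']
      push_cast
      rw [sub_mul, one_mul]
    rw [hgraph]
    refine ⟨fun h i => (hiff i).1 (by rw [h]), fun h => ext_inner_basis b fun i => (hiff i).2 (h i)⟩
  · exact sub_nonneg.2 ((one_le_inv₀ (hμpos i)).2 (hμ1 i))
  · simpa using summable_eigenvalues_of_sup_bound hm hJC b (fun i => (hμpos i).le) hμ

end DiscreteDirichlet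

theorem mainTheorem6 {X : Type*} [Countable X] [MeasurableSpace X] [DiscreteMeasurableSpace X]
    (m : X → ℝ) (hm : ∀ x, 0 < m x)
    (hfin : DiscreteDirichlet.weightMeasure m Set.univ < ⊤)
    (Q : DiscreteDirichlet.QuadForm m) (hQ : Q.IsDirichletForm)
    (α : ℝ) (hα : 0 ≤ α) (o : X) (hS : Q.SatisfiesSobolev ⊤ α o) :
    (∃! T : ℝ≥0 → DiscreteDirichlet.Ell2 m →L[ℂ] DiscreteDirichlet.Ell2 m,
      DiscreteDirichlet.IsSemigroupOf Q.generator T) ∧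
    (∀ T : ℝ≥0 → DiscreteDirichlet.Ell2 m →L[ℂ] DiscreteDirichlet.Ell2 m,
      DiscreteDirichlet.IsSemigroupOf Q.generator T →
        ∀ t : ℝ≥0, 0 < t → DiscreteDirichlet.IsTraceClass (T t)) ∧
    DiscreteDirichlet.HasPurelyDiscreteSpectrum Q.generator := by
  have : IsFiniteMeasure (DiscreteDirichlet.weightMeasure m) := ⟨hfin⟩
  obtain ⟨ι, b, lam, hL, h0, hs⟩ :=
    DiscreteDirichlet.QuadForm.exists_isDiagonal_generator hm hQ hα hS
  refine ⟨?_, fun T hT t ht => ?_, hL.hasPurelyDiscreteSpectrum h0 hs⟩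
  · obtain ⟨T, hT⟩ := hL.exists_isSemigroupOf h0
    exact ⟨T, hT, fun S hS => hL.isSemigroupOf_unique hS hT⟩
  · exact DiscreteDirichlet.isTraceClass_of_diagonal b (fun i => Real.exp_nonneg _)
      (DiscreteDirichlet.summable_exp_neg_mul h0 hs (NNReal.coe_pos.2 ht)) (hT.inner_basis hL t)
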